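/- \textbf{Games.} Let $G=(V,E)$ be a finite graph, $c\ge 1$ an integer and $[c]=\{1,\dots,c\}$. In a \emph{unit-weight equal-split coordination game} on $G$ with colors $[c]$ (and no individual preferences), every player $i\in V$ has a nonempty strategy set $S_i\subseteq[c]$; in a strategy profile $s\in\prod_{i\in V}S_i$ the utility of player $i$ is $u_i(s)=\tfrac12\,|\{j : \{i,j\}\in E,\ s_i=s_j\}|$, and the social welfare is $u(s)=\sum_{i\in V}u_i(s)$. For $\epsilon\ge1$, a profile $s$ is an $(\epsilon,1)$-equilibrium if $\epsilon\, u_i(s)\ge u_i(s_{-i},s_i')$ for every player $i$ and every $s_i'\in S_i$. The $(\epsilon,1)$-Price of Anarchy of a game is the maximum of $u(s^*)/u(s)$ over its $(\epsilon,1)$-equilibria $s$, where $s^*$ is a profile of maximum social welfare; the ratio is $\infty$ if $u(s)=0<u(s^*)$, and $1$ if $u(s^*)=0$. The $(\epsilon,1)$-PoA of a class of games is the supremum over the games in the class. Let $\mathcal G_{G,c}$ be the class of all unit-weight equal-split coordination games on $G$ with colors $[c]$, and let $G(n,p)$ be the random graph on $n$ nodes in which every edge is present independently with probability $p$. \textbf{Theorem.}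 Let $c^*\ge3$ be an integer. (1) There is a constant $d=d(c^*)>0$ such that for every $\epsilon\ge1$ and every sequence $p=p(n)\in[0,1]$ with $p(n)\le d/n$ for all $n\ge1$ and $n^2p(n)\to\infty$, $$\lim_{n\to\infty}\mathbb P_{G_n\sim G(n,p(n))}\left\{(\epsilon,1)\text{-PoA}(\mathcal G_{G_n,c^*})=\infty\right\}=1.$$ (2) For every constant $p\in(0,1)$ there is a constant $\beta_0=\beta_0(p,c^*)<\infty$ such that for every $\epsilon\ge1$, $$\lim_{n\to\infty}\mathbb P_{G_n\sim G(n,p)}\left\{(\epsilon,1)\text{-PoA}(\mathcal G_{G_n,c^*})\le\beta_0\right\}=1.$$ -/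

import Mathlib

open Filter Topology
open scoped ENNReal NNReal

noncomputable section

/-- A clustering game with player set `V` and colors `[c]` (modelled by `Fin c`).
The edge set of the underlying graph is partitioned into coordination edges `coord` and
anti-coordination edges `anti`. Only the values of `split` and `weight` at edges, and the values
of `pref i` on `strat i`, are part of the game's data. -/
structure ClusteringGame (V : Type*) (c : ℕ) where
  /-- the coordination edges -/
  coord : SimpleGraph V
  /-- the anti-coordination edges -/
  anti : SimpleGraph V
  disjoint_edges : Disjoint coord anti
  /-- the strategy set of each player -/
  strat : V → Set (Fin c)
  strat_nonempty : ∀ i, (strat i).Nonempty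
  /-- the split parameters `α i j` -/
  split : V → V → ℝ
  split_nonneg : ∀ i j, (coord ⊔ anti).Adj i j → 0 ≤ split i j
  split_add_pos : ∀ i j, (coord ⊔ anti).Adj i j → 0 < split i j + split j i
  /-- the edge weights -/
  weight : Sym2 V → ℝ
  weight_nonneg : ∀ e ∈ (coord ⊔ anti).edgeSet, 0 ≤ weight e
  /-- the individual preferences -/
  pref : V → Fin c → ℝ
  pref_nonneg : ∀ i, ∀ x ∈ strat i, 0 ≤ pref i x

namespace ClusteringGame

variable {V : Type*} {c : ℕ}

/-- The underlying undirected graph. -/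
def graph (Γ : ClusteringGame V c) : SimpleGraph V := Γ.coord ⊔ Γ.anti

/-- A strategy profile: every player chooses a color from her strategy set. -/
def IsProfile (Γ : ClusteringGame V c) (s : V → Fin c) : Prop := ∀ i, s i ∈ Γ.strat i

/-- What player `i` obtains from the edge `{i, j}` when it is satisfied. -/
def share (Γ : ClusteringGame V c) (i j : V) : ℝ :=
  Γ.split i j / (Γ.split i j + Γ.split j i) * Γ.weight s(i, j)

open Classical in
/-- The utility `u_i(s)` of player `i`. -/
def utility [Fintype V] (Γ : ClusteringGame V c) (s : V → Fin c) (i : V) : ℝ :=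
  Γ.pref i (s i)
    + ∑ j with Γ.coord.Adj i j ∧ s i = s j, Γ.share i j
    + ∑ j with Γ.anti.Adj i j ∧ s i ≠ s j, Γ.share i j

/-- The social welfare `u(s) = ∑ i, u_i(s)`. -/
def welfare [Fintype V] (Γ : ClusteringGame V c) (s : V → Fin c) : ℝ := ∑ i, Γ.utility s i

/-- `s` is a strategy profile of maximum social welfare. -/
def IsOptimal [Fintype V] (Γ : ClusteringGame V c) (s : V → Fin c) : Prop :=
  Γ.IsProfile s ∧ ∀ t, Γ.IsProfile t → Γ.welfare t ≤ Γ.welfare s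

/-- `s` is an `ε`-approximate `k`-strong equilibrium: for every nonempty coalition `K` of at most
`k` players and every joint deviation of `K` (resulting in the profile `t`), some member of `K`
does not improve her utility by more than the factor `ε`. -/
def IsEquilibrium [Fintype V] (Γ : ClusteringGame V c) (ε : ℝ) (k : ℕ) (s : V → Fin c) : Prop :=
  Γ.IsProfile s ∧
    ∀ K : Finset V, K.Nonempty → K.card ≤ k →
      ∀ t, Γ.IsProfile t → (∀ i, i ∉ K → t i = s i) →
        ∃ j ∈ K, Γ.utility t j ≤ ε * Γ.utility s j

/-- The ratio `a / b` of two nonnegative welfares, where `a` is the optimal one, with values in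
`[0, ∞]`: it is `∞` if `b = 0 < a`, and `1` if the optimal welfare `a` is zero (then every
profile is optimal). -/
def welfareRatio (a b : ℝ) : ℝ≥0∞ :=
  open Classical in if a = 0 then 1 else ENNReal.ofReal a / ENNReal.ofReal b

/-- The `(ε, k)`-Price of Anarchy of a game. -/
def priceOfAnarchy [Fintype V] (Γ : ClusteringGame V c) (ε : ℝ) (k : ℕ) : ℝ≥0∞ :=
  ⨆ (o : V → Fin c) (_ : Γ.IsOptimal o) (s : V → Fin c) (_ : Γ.IsEquilibrium ε k s),
    welfareRatio (Γ.welfare o) (Γ.welfare s)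

/-- The `(ε, k)`-Price of Anarchy of a class of games. -/
def classPriceOfAnarchy [Fintype V] (𝒢 : Set (ClusteringGame V c)) (ε : ℝ) (k : ℕ) : ℝ≥0∞ :=
  ⨆ Γ ∈ 𝒢, Γ.priceOfAnarchy ε k

/-- All edges are coordination edges. -/
def IsCoordination (Γ : ClusteringGame V c) : Prop := Γ.anti = ⊥

/-- The equal-split distribution rule. -/
def IsEqualSplit (Γ : ClusteringGame V c) : Prop :=
  ∀ i j, Γ.graph.Adj i j → Γ.split i j = Γ.split j i

/-- All edges have weight one. -/
def IsUnitWeight (Γ : ClusteringGame V c) : Prop := ∀ e ∈ Γ.graph.edgeSet, Γ.weight e = 1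

/-- There are no individual preferences. -/
def NoPreferences (Γ : ClusteringGame V c) : Prop := ∀ i, ∀ x ∈ Γ.strat i, Γ.pref i x = 0

/-- The class of all coordination games on `G` with arbitrary nonempty strategy sets in `[c]`,
equal-split distribution rule, unit weights and no individual preferences. -/
def unitCoordinationGames (G : SimpleGraph V) (c : ℕ) : Set (ClusteringGame V c) :=
  {Γ | Γ.graph = G ∧ Γ.IsCoordination ∧ Γ.IsEqualSplit ∧ Γ.IsUnitWeight ∧ Γ.NoPreferences}

end ClusteringGame

end

/-! Sparse case, with `d = 1/18`. A first-moment bound shows that with high probability no vertex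
set spans more edges than it has vertices. Every induced subgraph then has a vertex of degree at
most two, so the graph is 3-colorable by greedy coloring (`colorable_three_of_edgesIn_le`). The
number of isolated edges has mean at least `n²p/8`, which tends to infinity, and two such events are
correlated by a factor at most `(1-p)⁻⁴ → 1`, so by the second moment method an isolated edge `ab`
exists with high probability. Recolor `a` and `b` with two different colors and let only these two
players also choose a third color `x`, all others being fixed. The proper coloring has welfare zero,
and no single deviation makes an edge monochromatic, so it is an equilibrium for every `ε`. Moving
`a` and `b` together to `x` gives positive welfare, hence ratio `∞`
(`classPriceOfAnarchy_eq_top_of_isolated`).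

Dense case. A Chernoff-type bound and a union bound over at most `2ⁿ` vertex sets show that with
high probability every set of at least `n/c` vertices spans a fixed positive fraction of
`(n/c).choose 2` edges (`exists_measureReal_edgesIn_le`). In any profile some color is used by at
least `n/c` players, so the welfare of every profile, equilibrium or not, is of order `n²`. No
profile exceeds `n²/2`, so the ratio is bounded (`classPriceOfAnarchy_le`). -/

section Auxiliary

open MeasureTheory ProbabilityTheory
open scoped Classical

namespace SimpleGraph

variable {V : Type*}

/-! ### Independence of the possible edges in the binomial random graph. -/

instance [Finite V] : MeasurableSingletonClass (SimpleGraph V) where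
  measurableSet_singleton G := by
    have : ({G} : Set (SimpleGraph V)) = edgeSet ⁻¹' {G.edgeSet} := by ext; simp
    rw [this]
    exact measurable_edgeSet (measurableSet_singleton _)

/-- The possible edges of a graph with vertex set `V` that lie inside `T`. -/
noncomputable def slots (T : Finset V) : Finset (Sym2 V) :=
  T.offDiag.image (fun x => s(x.1, x.2))

/-- The possible edges of a graph with vertex set `V`. -/
noncomputable def allSlots (V : Type*) [Fintype V] : Finset (Sym2 V) :=
  Finset.univ.filter (fun e => ¬ e.IsDiag)

theorem mem_allSlots [Fintype V] {e : Sym2 V} : e ∈ allSlots V ↔ ¬ e.IsDiag := by simp [allSlots]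

theorem mk_mem_slots {T : Finset V} {u v : V} :
    s(u, v) ∈ slots T ↔ u ∈ T ∧ v ∈ T ∧ u ≠ v := by
  simp only [slots, Finset.mem_image, Finset.mem_offDiag, Prod.exists, Sym2.eq_iff]
  constructor
  · rintro ⟨a, b, h, ⟨rfl, rfl⟩ | ⟨rfl, rfl⟩⟩
    · exact h
    · exact ⟨h.2.1, h.1, h.2.2.symm⟩
  · intro h
    exact ⟨u, v, h, Or.inl ⟨rfl, rfl⟩⟩

theorem slots_subset_allSlots [Fintype V] (T : Finset V) : slots T ⊆ allSlots V := by
  intro e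
  induction e with
  | _ u v => simp [mk_mem_slots, mem_allSlots]

theorem card_slots (T : Finset V) : (slots T).card = T.card.choose 2 :=
  Sym2.card_image_offDiag T

theorem edgeFinset_subset_allSlots [Fintype V] (G : SimpleGraph V) : G.edgeFinset ⊆ allSlots V := by
  intro e he
  rw [mem_allSlots]
  exact G.not_isDiag_of_mem_edgeSet (by simpa using he)

theorem card_allSlots [Fintype V] : (allSlots V).card = (Fintype.card V).choose 2 := by
  rw [← Sym2.card_subtype_not_diag, Fintype.card_subtype, allSlots]

/-- Under the binomial random graph, the expectation of a product of functions of the individual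
possible edges is the product of the expectations. -/
theorem integral_prod_binomialRandom [Fintype V] (p : unitInterval) (a b : Sym2 V → ℝ) :
    ∫ G, ∏ e ∈ allSlots V, (if e ∈ G.edgeSet then a e else b e) ∂(binomialRandom V p)
      = ∏ e ∈ allSlots V, (p * a e + (1 - p) * b e) := by
  -- Expanding the product of sums gives one term per set of possible edges, that is, one term per
  -- graph.
  rw [integral_fintype (Integrable.of_finite), Finset.prod_add]
  refine Finset.sum_bij' (fun G _ => G.edgeFinset) (fun A _ => fromEdgeSet (A : Set (Sym2 V)))
    ?_ ?_ ?_ ?_ ?_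
  · intro G _
    simpa using edgeFinset_subset_allSlots G
  · simp
  · intro G _
    simp
  · intro A hA
    rw [Finset.mem_powerset] at hA
    ext e
    rw [← Finset.mem_coe, coe_edgeFinset, edgeSet_fromEdgeSet, Set.mem_sdiff, Finset.mem_coe]
    constructor
    · exact fun h => h.1
    · exact fun h => ⟨h, by simpa [mem_allSlots] using hA h⟩
  · intro G _
    have h1 : (binomialRandom V p).real {G} = (p : ℝ) ^ G.edgeFinset.card *
        (1 - p : ℝ) ^ (allSlots V \ G.edgeFinset).card := by
      rw [measureReal_def, binomialRandom_singleton,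
        Finset.card_sdiff_of_subset (edgeFinset_subset_allSlots G), card_allSlots,
        ← Set.ncard_coe_finset, coe_edgeFinset, Nat.card_eq_fintype_card]
      simp
    rw [h1, ← Finset.prod_sdiff (edgeFinset_subset_allSlots G), Finset.prod_mul_distrib,
      Finset.prod_mul_distrib, Finset.prod_const, Finset.prod_const]
    have h2 : ∏ e ∈ allSlots V \ G.edgeFinset, (if e ∈ G.edgeSet then a e else b e)
        = ∏ e ∈ allSlots V \ G.edgeFinset, b e :=
      Finset.prod_congr rfl fun e he => by
        rw [if_neg]; simpa using (Finset.mem_sdiff.1 he).2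
    have h3 : ∏ e ∈ G.edgeFinset, (if e ∈ G.edgeSet then a e else b e)
        = ∏ e ∈ G.edgeFinset, a e :=
      Finset.prod_congr rfl fun e he => by
        rw [if_pos]; simpa using he
    rw [h2, h3, smul_eq_mul]
    ring

/-- The probability that all of `A` and nothing of `B` is present. -/
theorem measureReal_cylinder [Fintype V] (p : unitInterval) {A B : Finset (Sym2 V)} (hA : A ⊆ allSlots V)
    (hB : B ⊆ allSlots V) (hAB : Disjoint A B) :
    (binomialRandom V p).real {G | (∀ e ∈ A, e ∈ G.edgeSet) ∧ ∀ e ∈ B, e ∉ G.edgeSet}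
      = (p : ℝ) ^ A.card * (1 - p : ℝ) ^ B.card := by
  -- A vanishing factor for each present edge of `B` and each absent edge of `A` turns the product
  -- into the indicator of the event.
  have key := integral_prod_binomialRandom (V := V) p (fun e => if e ∈ B then 0 else 1)
    (fun e => if e ∈ A then 0 else 1)
  have hl : ∀ G : SimpleGraph V, (∏ e ∈ allSlots V, (if e ∈ G.edgeSet then
      (if e ∈ B then (0 : ℝ) else 1) else (if e ∈ A then 0 else 1))) =
      Set.indicator {G | (∀ e ∈ A, e ∈ G.edgeSet) ∧ ∀ e ∈ B, e ∉ G.edgeSet} 1 G := by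
    intro G
    by_cases h : G ∈ {G | (∀ e ∈ A, e ∈ G.edgeSet) ∧ ∀ e ∈ B, e ∉ G.edgeSet}
    · rw [Set.indicator_of_mem h]
      refine Finset.prod_eq_one fun e _ => ?_
      obtain ⟨h1, h2⟩ := h
      have := h1 e
      have := h2 e
      split_ifs <;> simp_all
    · rw [Set.indicator_of_notMem h]
      simp only [Set.mem_ofPred_eq, not_and_or, not_forall] at h
      rcases h with ⟨e, he, h⟩ | ⟨e, he, h⟩
      · exact Finset.prod_eq_zero (hA he) (by simp [he, h])
      · exact Finset.prod_eq_zero (hB he) (by rw [not_not] at h; simp [he, h])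
  simp_rw [hl] at key
  rw [integral_indicator_one (Set.toFinite _).measurableSet] at key
  rw [key, ← Finset.prod_sdiff (Finset.union_subset hA hB), Finset.prod_union hAB]
  have e1 : ∏ e ∈ A, ((p : ℝ) * (if e ∈ B then 0 else 1) + (1 - p) * (if e ∈ A then 0 else 1))
      = (p : ℝ) ^ A.card := by
    rw [← Finset.prod_const]
    refine Finset.prod_congr rfl fun e he => ?_
    simp [he, Finset.disjoint_left.1 hAB he]
  have e2 : ∏ e ∈ B, ((p : ℝ) * (if e ∈ B then 0 else 1) + (1 - p) * (if e ∈ A then 0 else 1))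
      = (1 - p : ℝ) ^ B.card := by
    rw [← Finset.prod_const]
    refine Finset.prod_congr rfl fun e he => ?_
    simp [he, Finset.disjoint_right.1 hAB he]
  rw [e1, e2, Finset.prod_eq_one, one_mul]
  intro e he
  simp only [Finset.mem_sdiff, Finset.mem_union, not_or] at he
  simp [he.2.1, he.2.2]

/-- The number of edges of `G` in the set `M`. -/
noncomputable def edgesIn (G : SimpleGraph V) (M : Finset (Sym2 V)) : ℕ :=
  (M.filter (· ∈ G.edgeSet)).card

/-- Each possible edge in `M` contributes an independent factor of mean `1 - p/2`. This exponential
moment controls the lower tail of the edge count. -/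
theorem integral_half_pow_edgesIn [Fintype V] (p : unitInterval) {M : Finset (Sym2 V)}
    (hM : M ⊆ allSlots V) :
    ∫ G, (1 / 2 : ℝ) ^ (edgesIn G M) ∂(binomialRandom V p) = (1 - p / 2 : ℝ) ^ M.card := by
  have key := integral_prod_binomialRandom (V := V) p (fun e => if e ∈ M then 1 / 2 else 1)
    (fun e => 1)
  have hl : ∀ G : SimpleGraph V, (∏ e ∈ allSlots V, (if e ∈ G.edgeSet then
      (if e ∈ M then (1 / 2 : ℝ) else 1) else 1)) = (1 / 2 : ℝ) ^ (edgesIn G M) := by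
    intro G
    rw [edgesIn, ← Finset.prod_const, Finset.prod_filter, ← Finset.prod_sdiff hM,
      Finset.prod_eq_one, one_mul]
    · exact Finset.prod_congr rfl fun e he => by simp [he]
    · intro e he
      simp [(Finset.mem_sdiff.1 he).2]
  simp_rw [hl] at key
  rw [key, ← Finset.prod_sdiff hM, Finset.prod_eq_one, one_mul, ← Finset.prod_const]
  · refine Finset.prod_congr rfl fun e he => ?_
    simp [he]; ring
  · intro e he
    simp [(Finset.mem_sdiff.1 he).2]

/-- An event of the random graph whose complement has vanishing probability. -/
theorem tendsto_measure_one {p : ℕ → unitInterval} {A : ∀ n, Set (SimpleGraph (Fin n))}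
    {r : ℕ → ℝ} (hr : Tendsto r atTop (𝓝 0))
    (h : ∀ᶠ n in atTop, (binomialRandom (Fin n) (p n)).real (A n)ᶜ ≤ r n) :
    Tendsto (fun n => binomialRandom (Fin n) (p n) (A n)) atTop (𝓝 1) := by
  have h0 : Tendsto (fun n => (binomialRandom (Fin n) (p n)).real (A n)ᶜ) atTop (𝓝 0) :=
    tendsto_of_tendsto_of_tendsto_of_le_of_le' tendsto_const_nhds hr
      (Eventually.of_forall fun _ => measureReal_nonneg) h
  have h1 : Tendsto (fun n => (binomialRandom (Fin n) (p n)).real (A n)) atTop (𝓝 1) := by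
    have : ∀ n, (binomialRandom (Fin n) (p n)).real (A n)
        = 1 - (binomialRandom (Fin n) (p n)).real (A n)ᶜ := fun n => by
      rw [probReal_compl_eq_one_sub (Set.toFinite _).measurableSet]; ring
    simp_rw [this]
    simpa using h0.const_sub 1
  have h2 := ENNReal.tendsto_ofReal h1
  simpa using h2

/-! ### First moment: no overfull vertex sets in a sparse graph. -/

/-- The contribution of the `k`-sets to the union bound. There are about `n^k` sets against
`n^(-(k+1))` from the edges, so a factor `1/n` survives; the rest is geometric in `k`. -/
theorem choose_mul_choose_mul_pow_le {n k : ℕ} (hn : 1 ≤ n) {p : ℝ} (hp : 0 ≤ p)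
    (hpn : p ≤ 1 / 18 / n) :
    (n.choose k : ℝ) * ((k.choose 2).choose (k + 1) * p ^ (k + 1)) ≤ (1 / 2) ^ k / n := by
  have hn' : (0 : ℝ) < n := by exact_mod_cast hn
  have h1 : (n.choose k : ℝ) ≤ (n : ℝ) ^ k / k.factorial := Nat.choose_le_pow_div k n
  have h2 : (k.choose 2 : ℝ) ≤ (k : ℝ) ^ 2 / 2 := by
    simpa using Nat.choose_le_pow_div (α := ℝ) 2 k
  have h3 : ((k.choose 2).choose (k + 1) : ℝ) ≤ ((k : ℝ) ^ 2 / 2) ^ (k + 1) / (k + 1).factorial :=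
    (Nat.choose_le_pow_div (α := ℝ) (k + 1) (k.choose 2)).trans (by gcongr)
  have h4 : p ^ (k + 1) ≤ (1 / 18 / n) ^ (k + 1) := by gcongr
  have he : Real.exp k ≤ 3 ^ k := by
    rw [← mul_one (k : ℝ), Real.exp_nat_mul]
    gcongr
    exact Real.exp_one_lt_three.le
  have h5 : (k : ℝ) ^ k / k.factorial ≤ 3 ^ k :=
    (Real.pow_div_factorial_le_exp k k.cast_nonneg k).trans he
  have h6 : (k : ℝ) ^ (k + 1) / (k + 1).factorial ≤ 3 ^ k :=
    (Real.pow_div_factorial_le_exp k k.cast_nonneg (k + 1)).trans he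
  have h7 : (k : ℝ) ≤ 2 ^ k := by exact_mod_cast Nat.lt_two_pow_self.le
  calc (n.choose k : ℝ) * ((k.choose 2).choose (k + 1) * p ^ (k + 1))
      ≤ (n : ℝ) ^ k / k.factorial * (((k : ℝ) ^ 2 / 2) ^ (k + 1) / (k + 1).factorial *
          (1 / 18 / n) ^ (k + 1)) := by gcongr
    -- Splitting `(k²)^(k+1)` this way lets each factorial absorb a power of `k` at cost `e^k ≤
    -- 3^k`.
    _ = ((k : ℝ) ^ k / k.factorial) * ((k : ℝ) ^ (k + 1) / (k + 1).factorial) * k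
          * (1 / 36) ^ (k + 1) / n := by
        have : ((k : ℝ) ^ 2 / 2) ^ (k + 1) * (1 / 18 / n) ^ (k + 1)
            = (k : ℝ) ^ k * (k : ℝ) ^ (k + 1) * k * (1 / 36) ^ (k + 1) / n ^ (k + 1) := by
          rw [← mul_pow, show (k : ℝ) ^ 2 / 2 * (1 / 18 / n) = k ^ 2 * (1 / 36) / n by ring,
            div_pow, mul_pow]
          ring
        calc _ = (n : ℝ) ^ k * (((k : ℝ) ^ 2 / 2) ^ (k + 1) * (1 / 18 / n) ^ (k + 1))
                / (k.factorial * (k + 1).factorial) := by ring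
          _ = _ := by rw [this]; field_simp; ring
    -- The constant 18 is `3·3·2`: with the `1/2` from `k.choose 2 ≤ k²/2`, the ratio becomes `18/36
    -- = 1/2`.
    _ ≤ 3 ^ k * 3 ^ k * 2 ^ k * (1 / 36) ^ (k + 1) / n := by gcongr
    _ = (1 / 2) ^ k / n * (1 / 36) := by
        rw [pow_succ, ← mul_pow, ← mul_pow, ← mul_assoc, ← mul_pow]; norm_num; ring
    _ ≤ (1 / 2) ^ k / n := mul_le_of_le_one_right (by positivity) (by norm_num)

/-- In a sparse random graph it is unlikely that some set of vertices spans more edges than it has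
vertices. -/
theorem measureReal_exists_card_lt_edgesIn_le {n : ℕ} (hn : 1 ≤ n) (p : unitInterval)
    (hp : (p : ℝ) ≤ 1 / 18 / n) :
    (binomialRandom (Fin n) p).real {G | ∃ T : Finset (Fin n), T.card < edgesIn G (slots T)}
      ≤ 2 / n := by
  have hsub : {G : SimpleGraph (Fin n) | ∃ T : Finset (Fin n), T.card < edgesIn G (slots T)} ⊆
      ⋃ T ∈ (Finset.univ : Finset (Finset (Fin n))), ⋃ F ∈ (slots T).powersetCard (T.card + 1),
        {G | (∀ e ∈ F, e ∈ G.edgeSet) ∧ ∀ e ∈ (∅ : Finset (Sym2 (Fin n))), e ∉ G.edgeSet} := by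
    rintro G ⟨T, hT⟩
    obtain ⟨F, hF, hc⟩ := Finset.exists_subset_card_eq (Nat.succ_le_of_lt hT)
    simp only [Set.mem_iUnion, Finset.mem_powersetCard]
    refine ⟨T, Finset.mem_univ _, F, ⟨hF.trans (Finset.filter_subset _ _), hc⟩, ?_, by simp⟩
    intro e he
    exact (Finset.mem_filter.1 (hF he)).2
  refine (measureReal_mono hsub (measure_ne_top _ _)).trans ((measureReal_biUnion_finset_le _ _).trans ?_)
  have hT : ∀ T : Finset (Fin n), (binomialRandom (Fin n) p).real
      (⋃ F ∈ (slots T).powersetCard (T.card + 1), {G | (∀ e ∈ F, e ∈ G.edgeSet) ∧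
        ∀ e ∈ (∅ : Finset (Sym2 (Fin n))), e ∉ G.edgeSet}) ≤
      ((T.card.choose 2).choose (T.card + 1) : ℝ) * (p : ℝ) ^ (T.card + 1) := by
    intro T
    refine (measureReal_biUnion_finset_le _ _).trans ?_
    rw [← card_slots, ← Finset.card_powersetCard, ← nsmul_eq_mul, ← Finset.sum_const]
    refine Finset.sum_le_sum fun F hF => ?_
    rw [Finset.mem_powersetCard] at hF
    rw [measureReal_cylinder p (hF.1.trans (slots_subset_allSlots T)) (Finset.empty_subset _)
      (Finset.disjoint_empty_right _), hF.2]
    simp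
  refine (Finset.sum_le_sum fun T _ => hT T).trans ?_
  rw [← Finset.powerset_univ, Finset.sum_powerset_apply_card
    (fun k => ((k.choose 2).choose (k + 1) : ℝ) * (p : ℝ) ^ (k + 1)), Finset.card_univ,
    Fintype.card_fin]
  calc ∑ k ∈ Finset.range (n + 1),
        n.choose k • (((k.choose 2).choose (k + 1) : ℝ) * (p : ℝ) ^ (k + 1))
      ≤ ∑ k ∈ Finset.range (n + 1), (1 / 2 : ℝ) ^ k / n := by
        refine Finset.sum_le_sum fun k _ => ?_
        rw [nsmul_eq_mul]
        exact choose_mul_choose_mul_pow_le hn p.2.1 hp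
    _ = (∑ k ∈ Finset.range (n + 1), (1 / 2 : ℝ) ^ k) / n := by rw [Finset.sum_div]
    _ ≤ 2 / n := by
        gcongr
        have := Summable.sum_le_tsum (Finset.range (n + 1)) (fun k _ => by positivity)
          summable_geometric_two
        rwa [tsum_geometric_two] at this

/-! ### Second moment: isolated edges in a sparse graph. -/

/-- The second moment method for a family of events with bounded positive correlations. -/
theorem measureReal_forall_notMem_le {Ω ι : Type*} [MeasurableSpace Ω] [Finite Ω]
    [MeasurableSingletonClass Ω] (P : Measure Ω) [IsProbabilityMeasure P] (E : Finset ι)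
    (I : ι → Set Ω) {c : ℝ} (hc : 0 < c)
    (hI : ∀ e ∈ E, ∀ f ∈ E, e ≠ f → P.real (I e ∩ I f) * c ≤ P.real (I e) * P.real (I f))
    (hpos : 0 < ∑ e ∈ E, P.real (I e)) :
    P.real {ω | ∀ e ∈ E, ω ∉ I e} ≤ 1 / (∑ e ∈ E, P.real (I e)) + (1 / c - 1) := by
  set m := ∑ e ∈ E, P.real (I e) with hm
  let X : Ω → ℝ := fun ω => ∑ e ∈ E, (I e).indicator 1 ω
  have hint : ∀ f : Ω → ℝ, Integrable f P := fun f => Integrable.of_finite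
  have hms : ∀ S : Set Ω, MeasurableSet S := fun S => (Set.toFinite S).measurableSet
  have hX1 : ∫ ω, X ω ∂P = m := by
    rw [integral_finsetSum _ fun _ _ => hint _]
    exact Finset.sum_congr rfl fun e _ => integral_indicator_one (hms _)
  have hX2 : ∫ ω, X ω ^ 2 ∂P = ∑ e ∈ E, ∑ f ∈ E, P.real (I e ∩ I f) := by
    have : ∀ ω, X ω ^ 2 = ∑ e ∈ E, ∑ f ∈ E, (I e ∩ I f).indicator (1 : Ω → ℝ) ω := by
      intro ω
      simp only [X, sq, Finset.sum_mul_sum, Set.inter_indicator_one, Pi.mul_apply]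
    simp_rw [this]
    rw [integral_finsetSum _ fun _ _ => hint _]
    refine Finset.sum_congr rfl fun e _ => ?_
    rw [integral_finsetSum _ fun _ _ => hint _]
    exact Finset.sum_congr rfl fun f _ => integral_indicator_one (hms _)
  -- The diagonal pairs contribute `m`, the others at most `m²/c`.
  have hX2le : ∫ ω, X ω ^ 2 ∂P ≤ m + m ^ 2 / c := by
    have : m + m ^ 2 / c = ∑ e ∈ E, ∑ f ∈ E,
        ((if e = f then P.real (I e) else 0) + P.real (I e) * P.real (I f) / c) := by
      simp only [Finset.sum_add_distrib, Finset.sum_ite_eq, Finset.sum_ite_mem, Finset.inter_self]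
      rw [sq, hm, Finset.sum_mul_sum, Finset.sum_div]
      simp_rw [Finset.sum_div]
    rw [hX2, this]
    refine Finset.sum_le_sum fun e he => Finset.sum_le_sum fun f hf => ?_
    by_cases hef : e = f
    · subst hef
      rw [if_pos rfl, Set.inter_self]
      exact le_add_of_nonneg_right (by positivity)
    · rw [if_neg hef, zero_add, le_div_iff₀ hc]
      exact hI e he f hf hef
  have hvar : ∫ ω, (X ω - m) ^ 2 ∂P = ∫ ω, X ω ^ 2 ∂P - m ^ 2 := by
    have : ∀ ω, (X ω - m) ^ 2 = X ω ^ 2 - (2 * m * X ω - m ^ 2) := fun ω => by ring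
    simp_rw [this]
    rw [integral_sub (hint _) (hint _), integral_sub (hint _) (hint _), integral_const_mul, hX1]
    simp
    ring
  -- Chebyshev: on this event `X = 0`, so `(X - m)² = m²`.
  have hle : P.real {ω | ∀ e ∈ E, ω ∉ I e} * m ^ 2 ≤ ∫ ω, (X ω - m) ^ 2 ∂P := by
    rw [← integral_indicator_one (hms _), ← integral_mul_const]
    refine integral_mono (hint _) (hint _) fun ω => ?_
    by_cases h : ω ∈ {ω | ∀ e ∈ E, ω ∉ I e}
    · have : X ω = 0 := Finset.sum_eq_zero fun e he => Set.indicator_of_notMem (h e he) _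
      simp only [Set.indicator_of_mem h, this]
      simp
    · simp only [Set.indicator_of_notMem h]
      simpa using sq_nonneg (X ω - m)
  have hfin : P.real {ω | ∀ e ∈ E, ω ∉ I e} * m ^ 2 ≤ (1 / m + (1 / c - 1)) * m ^ 2 := by
    have : (1 / m + (1 / c - 1)) * m ^ 2 = m + m ^ 2 / c - m ^ 2 := by
      field_simp
      ring
    linarith
  exact le_of_mul_le_mul_right hfin (by positivity)

section Isolated

variable {V : Type*} [Fintype V]

/-- The possible edges other than `e` that share a vertex with `e`. -/
noncomputable def incidentSlots (e : Sym2 V) : Finset (Sym2 V) :=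
  (allSlots V).filter (fun f => f ≠ e ∧ ∃ v ∈ e, v ∈ f)

theorem mem_incidentSlots {e f : Sym2 V} :
    f ∈ incidentSlots e ↔ ¬ f.IsDiag ∧ f ≠ e ∧ ∃ v ∈ e, v ∈ f := by
  simp [incidentSlots, mem_allSlots]

theorem incidentSlots_subset (e : Sym2 V) : incidentSlots e ⊆ allSlots V :=
  Finset.filter_subset _ _

/-- The graphs in which `e` is an isolated edge. -/
def isolatedEdge (e : Sym2 V) : Set (SimpleGraph V) :=
  {G | e ∈ G.edgeSet ∧ ∀ f ∈ incidentSlots e, f ∉ G.edgeSet}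

theorem measureReal_isolatedEdge (p : unitInterval) {e : Sym2 V} (he : e ∈ allSlots V) :
    (binomialRandom V p).real (isolatedEdge e)
      = (p : ℝ) * (1 - p : ℝ) ^ (incidentSlots e).card := by
  have := measureReal_cylinder p (A := {e}) (by simpa using he) (incidentSlots_subset e)
    (by simp [mem_incidentSlots])
  simpa [isolatedEdge] using this

theorem card_incidentSlots_le (e : Sym2 V) : (incidentSlots e).card ≤ 2 * Fintype.card V := by
  induction e with
  | _ a b =>
    have : incidentSlots s(a, b) ⊆ Finset.univ.image (fun x => s(a, x)) ∪
        Finset.univ.image (fun x => s(b, x)) := by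
      intro f hf
      obtain ⟨_, _, v, hv, hvf⟩ := mem_incidentSlots.1 hf
      obtain ⟨w, rfl⟩ := hvf
      rcases Sym2.mem_iff.1 hv with rfl | rfl <;> simp
    refine (Finset.card_le_card this).trans ((Finset.card_union_le _ _).trans ?_)
    rw [two_mul]
    exact add_le_add Finset.card_image_le Finset.card_image_le

/-- A slot meeting two disjoint edges joins an endpoint of one to an endpoint of the other. -/
theorem card_incidentSlots_inter_le {e f : Sym2 V} (hef : ∀ v ∈ e, v ∉ f) :
    (incidentSlots e ∩ incidentSlots f).card ≤ 4 := by
  induction e with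
  | _ a b =>
    induction f with
    | _ x y =>
      have : incidentSlots s(a, b) ∩ incidentSlots s(x, y)
          ⊆ {s(a, x), s(a, y), s(b, x), s(b, y)} := by
        intro g hg
        obtain ⟨hg1, hg2⟩ := Finset.mem_inter.1 hg
        obtain ⟨_, _, v, hv, hvg⟩ := mem_incidentSlots.1 hg1
        obtain ⟨_, _, w, hw, hwg⟩ := mem_incidentSlots.1 hg2
        have hvw : v ≠ w := by
          rintro rfl
          exact hef v hv hw
        have : g = s(v, w) := (Sym2.mem_and_mem_iff hvw).1 ⟨hvg, hwg⟩
        rw [this]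
        rcases Sym2.mem_iff.1 hv with rfl | rfl <;> rcases Sym2.mem_iff.1 hw with rfl | rfl <;>
          simp
      exact (Finset.card_le_card this).trans Finset.card_le_four

/-- For disjoint edges, the product of probabilities counts the at most four common slots twice,
which costs at most `(1-p)^4`. Distinct edges with a common vertex cannot both be isolated. -/
theorem measureReal_isolatedEdge_inter_le (p : unitInterval) {e f : Sym2 V}
    (he : e ∈ allSlots V) (hf : f ∈ allSlots V) (hne : e ≠ f) :
    (binomialRandom V p).real (isolatedEdge e ∩ isolatedEdge f) * (1 - p : ℝ) ^ 4 ≤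
      (binomialRandom V p).real (isolatedEdge e) * (binomialRandom V p).real (isolatedEdge f) := by
  have hq0 : (0 : ℝ) ≤ 1 - p := by linarith [p.2.2]
  have hq1 : (1 - p : ℝ) ≤ 1 := by linarith [p.2.1]
  by_cases hef : ∀ v ∈ e, v ∉ f
  · have h1 : isolatedEdge e ∩ isolatedEdge f = {G | (∀ g ∈ ({e, f} : Finset (Sym2 V)),
        g ∈ G.edgeSet) ∧ ∀ g ∈ incidentSlots e ∪ incidentSlots f, g ∉ G.edgeSet} := by
      ext G
      simp only [isolatedEdge, Set.mem_inter_iff, Set.mem_ofPred_eq, Finset.mem_insert,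
        Finset.mem_singleton, Finset.mem_union, forall_eq, or_imp,
        forall_and]
      tauto
    have hd : Disjoint ({e, f} : Finset (Sym2 V)) (incidentSlots e ∪ incidentSlots f) := by
      rw [Finset.disjoint_left]
      simp only [Finset.mem_insert, Finset.mem_singleton, Finset.mem_union, mem_incidentSlots]
      rintro g (rfl | rfl) (⟨-, h2, v, hv, hv'⟩ | ⟨-, h2, v, hv, hv'⟩)
      · exact h2 rfl
      · exact hef v hv' hv
      · exact hef v hv hv'
      · exact h2 rfl
    have h2 := measureReal_cylinder p (A := {e, f}) (by simp [Finset.insert_subset_iff, he, hf])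
      (Finset.union_subset (incidentSlots_subset e) (incidentSlots_subset f)) hd
    rw [h1, h2, measureReal_isolatedEdge p he, measureReal_isolatedEdge p hf,
      Finset.card_pair hne]
    have h3 := Finset.card_union_add_card_inter (incidentSlots e) (incidentSlots f)
    have h4 := card_incidentSlots_inter_le hef
    calc (p : ℝ) ^ 2 * (1 - p : ℝ) ^ (incidentSlots e ∪ incidentSlots f).card * (1 - p : ℝ) ^ 4
        ≤ (p : ℝ) ^ 2 * (1 - p : ℝ) ^ (incidentSlots e ∪ incidentSlots f).card *
          (1 - p : ℝ) ^ (incidentSlots e ∩ incidentSlots f).card := by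
          have := p.2.1
          have := pow_le_pow_of_le_one hq0 hq1 h4
          gcongr
      _ = (p : ℝ) ^ 2 * ((1 - p : ℝ) ^ (incidentSlots e).card *
            (1 - p : ℝ) ^ (incidentSlots f).card) := by
          rw [mul_assoc, ← pow_add, h3, pow_add]
      _ = _ := by ring
  · have : isolatedEdge e ∩ isolatedEdge f = ∅ := by
      rw [Set.eq_empty_iff_forall_notMem]
      rintro G ⟨h1, h2⟩
      push Not at hef
      obtain ⟨v, hv, hv'⟩ := hef
      exact h1.2 f (mem_incidentSlots.2 ⟨mem_allSlots.1 hf, hne.symm, v, hv, hv'⟩) h2.1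
    rw [this]
    simp only [measureReal_empty, zero_mul]
    positivity

end Isolated

/-- A sparse random graph with many edges is likely to have an isolated edge. -/
theorem measureReal_no_isolatedEdge_le {n : ℕ} (hn : 2 ≤ n) (p : unitInterval)
    (hp0 : 0 < (p : ℝ)) (hp : (p : ℝ) ≤ 1 / 18 / n) :
    (binomialRandom (Fin n) p).real {G | ∀ e ∈ allSlots (Fin n), G ∉ isolatedEdge e}
      ≤ 8 * ((n : ℝ) ^ 2 * p)⁻¹ + (1 / (1 - p : ℝ) ^ 4 - 1) := by
  have hn' : (2 : ℝ) ≤ n := by exact_mod_cast hn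
  have hnp : (n : ℝ) * p ≤ 1 / 18 := by
    rw [le_div_iff₀ (by linarith)] at hp
    linarith
  have hp1 : (p : ℝ) ≤ 1 / 18 := by nlinarith
  have hlow : (n : ℝ) ^ 2 * p / 8 ≤
      ∑ e ∈ allSlots (Fin n), (binomialRandom (Fin n) p).real (isolatedEdge e) := by
    have h1 : ∀ e ∈ allSlots (Fin n), (p : ℝ) * (1 / 2) ≤
        (binomialRandom (Fin n) p).real (isolatedEdge e) := by
      intro e he
      rw [measureReal_isolatedEdge p he]
      gcongr
      have hc := card_incidentSlots_le e
      rw [Fintype.card_fin] at hc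
      -- Bernoulli: `(1-p)^(2n) ≥ 1 - 2np ≥ 8/9`, more than the required `1/2`.
      have hb := one_add_mul_le_pow (a := -(p : ℝ)) (by linarith) (2 * n)
      have := pow_le_pow_of_le_one (a := 1 - (p : ℝ)) (by linarith) (by linarith) hc
      rw [← sub_eq_add_neg] at hb
      push_cast at hb
      linarith
    have h2 := Finset.card_nsmul_le_sum _ _ _ h1
    rw [card_allSlots, Fintype.card_fin, nsmul_eq_mul, Nat.cast_choose_two] at h2
    refine le_trans ?_ h2
    have : (n : ℝ) ^ 2 / 4 ≤ n * (n - 1) / 2 := by nlinarith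
    calc (n : ℝ) ^ 2 * p / 8 = (n : ℝ) ^ 2 / 4 * (p * (1 / 2)) := by ring
      _ ≤ _ := by gcongr
  have hpos : 0 < (n : ℝ) ^ 2 * p / 8 := by positivity
  refine (measureReal_forall_notMem_le (binomialRandom (Fin n) p) (allSlots (Fin n)) isolatedEdge
    (c := (1 - p : ℝ) ^ 4) (pow_pos (by linarith) 4)
    (fun e he f hf hef => measureReal_isolatedEdge_inter_le p he hf hef)
    (hpos.trans_le hlow)).trans ?_
  gcongr
  calc 1 / _ ≤ 1 / ((n : ℝ) ^ 2 * p / 8) := one_div_le_one_div_of_le hpos hlow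
    _ = _ := by field_simp

/-! ### Large vertex sets in a dense graph. -/

/-- A random graph with few edges within a given set is unlikely. -/
theorem measureReal_edgesIn_le {V : Type*} [Fintype V] (p : unitInterval) {M : Finset (Sym2 V)}
    (hM : M ⊆ allSlots V) (m : ℕ) :
    (binomialRandom V p).real {G | edgesIn G M ≤ m} ≤ 2 ^ m * (1 - p / 2 : ℝ) ^ M.card := by
  rw [← integral_half_pow_edgesIn p hM, ← integral_const_mul,
    ← integral_indicator_one (Set.toFinite _).measurableSet]
  -- Markov's inequality for `(1/2)^(edgesIn G M)`.
  refine integral_mono Integrable.of_finite Integrable.of_finite fun G => ?_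
  by_cases h : G ∈ {G | edgesIn G M ≤ m}
  · simp only [Set.indicator_of_mem h, Pi.one_apply]
    calc (1 : ℝ) = 2 ^ m * (1 / 2) ^ m := by rw [← mul_pow]; norm_num
      _ ≤ 2 ^ m * (1 / 2) ^ edgesIn G M := by
        have := pow_le_pow_of_le_one (a := (1 / 2 : ℝ)) (by norm_num) (by norm_num) h
        gcongr
  · simp only [Set.indicator_of_notMem h]
    positivity

/-- In a dense random graph, with high probability all vertex sets of linear size span a positive
proportion of the possible edges. -/
theorem exists_measureReal_edgesIn_le {c : ℕ} (hc : 0 < c) (p : unitInterval) (hp : 0 < p) :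
    ∃ K : ℕ, 0 < K ∧ ∀ᶠ n : ℕ in atTop, (binomialRandom (Fin n) p).real
      {G | ∃ T : Finset (Fin n), n / c ≤ T.card ∧ K * edgesIn G (slots T) ≤ (n / c).choose 2}
        ≤ 2 ^ c * (1 / 2) ^ (n / c) := by
  have hp0 : (0 : ℝ) < p := hp
  have hp1 : (p : ℝ) ≤ 1 := p.2.2
  set u : ℝ := 1 - p / 2 with hu
  -- A fourth root splits `u ^ k.choose 2` into two equal factors: one absorbs `2^m`, by the choice
  -- of `K` with `(t²)^K < 1/2`, and the other, `t^(k(k-1))`, beats the number of vertex sets.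
  set t : ℝ := √(√u) with ht
  have hu0 : 0 ≤ u := by rw [hu]; linarith
  have ht0 : 0 ≤ t := Real.sqrt_nonneg _
  have ht4 : t ^ 2 * t ^ 2 = u := by
    rw [ht, Real.sq_sqrt (Real.sqrt_nonneg _), Real.mul_self_sqrt hu0]
  have ht1 : t < 1 := by
    rw [ht, Real.sqrt_lt' one_pos, one_pow, Real.sqrt_lt' one_pos]
    rw [hu]; linarith
  have ht21 : t ^ 2 < 1 := pow_lt_one₀ ht0 ht1 two_ne_zero
  obtain ⟨K, hK⟩ := exists_pow_lt_of_lt_one (show (0 : ℝ) < 1 / 2 by norm_num) ht21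
  have hKpos : 0 < K := by
    rcases Nat.eq_zero_or_pos K with rfl | h
    · norm_num at hK
    · exact h
  refine ⟨K, hKpos, ?_⟩
  have hlim : ∀ᶠ k : ℕ in atTop, (2 : ℝ) ^ c * t ^ (k - 1) ≤ 1 / 2 := by
    have h1 : Tendsto (fun k : ℕ => (2 : ℝ) ^ c * t ^ (k - 1)) atTop (𝓝 (2 ^ c * 0)) :=
      ((tendsto_pow_atTop_nhds_zero_of_lt_one ht0 ht1).comp (tendsto_sub_atTop_nat 1)).const_mul _
    rw [mul_zero] at h1
    exact h1.eventually_le_const (by norm_num)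
  filter_upwards [(Nat.tendsto_div_const_atTop hc.ne').eventually hlim] with n hn
  set k := n / c with hk
  set m := k.choose 2 / K with hm
  have hsub : {G : SimpleGraph (Fin n) | ∃ T : Finset (Fin n), k ≤ T.card ∧
      K * edgesIn G (slots T) ≤ k.choose 2} ⊆
      ⋃ T ∈ (Finset.univ : Finset (Finset (Fin n))).filter (fun T => k ≤ T.card),
        {G | edgesIn G (slots T) ≤ m} := by
    rintro G ⟨T, h1, h2⟩
    simp only [Set.mem_iUnion]
    refine ⟨T, by simpa using h1, ?_⟩
    rw [Set.mem_ofPred_eq, hm, Nat.le_div_iff_mul_le hKpos, mul_comm]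
    exact h2
  refine (measureReal_mono hsub (measure_ne_top _ _)).trans ((measureReal_biUnion_finset_le _ _).trans ?_)
  have hT : ∀ T ∈ (Finset.univ : Finset (Finset (Fin n))).filter (fun T => k ≤ T.card),
      (binomialRandom (Fin n) p).real {G | edgesIn G (slots T) ≤ m} ≤ t ^ (k * (k - 1)) := by
    intro T hT
    replace hT : k ≤ T.card := by simpa using hT
    refine (measureReal_edgesIn_le p (slots_subset_allSlots T) m).trans ?_
    rw [card_slots, ← hu]
    have h2k : k.choose 2 * 2 = k * (k - 1) := by
      rw [Nat.choose_two_right, Nat.div_mul_cancel (Nat.even_mul_pred_self k).two_dvd]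
    calc (2 : ℝ) ^ m * u ^ T.card.choose 2 ≤ 2 ^ m * u ^ k.choose 2 := by
          have := pow_le_pow_of_le_one hu0 (by rw [hu]; linarith) (Nat.choose_le_choose 2 hT)
          gcongr
      _ = 2 ^ m * (t ^ 2) ^ k.choose 2 * (t ^ 2) ^ k.choose 2 := by rw [← ht4, mul_pow]; ring
      _ ≤ 2 ^ m * (t ^ 2) ^ (K * m) * (t ^ 2) ^ k.choose 2 := by
          have := pow_le_pow_of_le_one (by positivity) ht21.le (Nat.mul_div_le (k.choose 2) K)
          gcongr
      _ = (2 * (t ^ 2) ^ K) ^ m * t ^ (k * (k - 1)) := by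
          rw [mul_pow, pow_mul, ← h2k, mul_comm (k.choose 2) 2, pow_mul t]
      _ ≤ 1 * t ^ (k * (k - 1)) := by
          gcongr
          exact pow_le_one₀ (by positivity) (by linarith)
      _ = _ := one_mul _
  refine (Finset.sum_le_card_nsmul _ _ _ hT).trans ?_
  rw [nsmul_eq_mul]
  -- As `n ≤ c(k+1)`, the number of sets is exponential in `k` only linearly, against the quadratic
  -- exponent of `t`.
  have hcard : (((Finset.univ : Finset (Finset (Fin n))).filter (fun T => k ≤ T.card)).card : ℝ)
      ≤ 2 ^ (c * (k + 1)) := by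
    have h1 : ((Finset.univ : Finset (Finset (Fin n))).filter (fun T => k ≤ T.card)).card
        ≤ 2 ^ n := by
      refine (Finset.card_filter_le _ _).trans ?_
      simp
    have h2 : n ≤ c * (k + 1) := (Nat.lt_mul_div_succ n hc).le
    exact_mod_cast h1.trans (Nat.pow_le_pow_right two_pos h2)
  calc _ ≤ (2 : ℝ) ^ (c * (k + 1)) * t ^ (k * (k - 1)) := by gcongr
    _ = 2 ^ c * (2 ^ c * t ^ (k - 1)) ^ k := by
        rw [mul_pow, mul_add, pow_add, mul_one, ← pow_mul, ← pow_mul, mul_comm (k - 1) k]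
        ring
    _ ≤ 2 ^ c * (1 / 2) ^ k := by gcongr

end SimpleGraph

/-! ### Coloring graphs without overfull vertex sets. -/

namespace SimpleGraph

variable {V : Type*} [Fintype V]

theorem sum_card_filter_adj (G : SimpleGraph V) (T : Finset V) :
    ∑ v ∈ T, (T.filter (G.Adj v)).card = 2 * edgesIn G (slots T) := by
  -- The edges inside `T`, on all of `V`: vertices outside `T` have degree zero, so the handshake
  -- identity for `H` is the claim.
  let H : SimpleGraph V :=
    { Adj := fun u v => G.Adj u v ∧ u ∈ T ∧ v ∈ T
      symm := ⟨fun u v h => ⟨h.1.symm, h.2.2, h.2.1⟩⟩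
      loopless := ⟨fun u h => G.loopless.irrefl u h.1⟩ }
  have hdeg : ∀ v, H.degree v = if v ∈ T then (T.filter (G.Adj v)).card else 0 := by
    intro v
    rw [← card_neighborFinset_eq_degree, neighborFinset_eq_filter]
    by_cases hv : v ∈ T
    · rw [if_pos hv]
      congr 1
      ext w
      simp [H, hv, and_comm]
    · simp [H, hv]
  have hedge : H.edgeFinset = (slots T).filter (· ∈ G.edgeSet) := by
    ext e
    induction e with
    | _ u v =>
      simp only [mem_edgeFinset, mem_edgeSet, Finset.mem_filter, mk_mem_slots, H]
      constructor
      · exact fun h => ⟨⟨h.2.1, h.2.2, h.1.ne⟩, h.1⟩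
      · exact fun h => ⟨h.2, h.1.1, h.1.2.1⟩
  have h := H.sum_degrees_eq_twice_card_edges
  rw [hedge] at h
  simp_rw [hdeg] at h
  rw [Finset.sum_ite_mem, Finset.univ_inter] at h
  exact h

/-- A graph none of whose vertex sets spans more edges than it has vertices is `3`-colorable. -/
theorem colorable_three_of_edgesIn_le (G : SimpleGraph V)
    (h : ∀ T : Finset V, edgesIn G (slots T) ≤ T.card) : G.Colorable 3 := by
  have key : ∀ S : Finset V, ∃ f : V → Fin 3, ∀ u ∈ S, ∀ v ∈ S, G.Adj u v → f u ≠ f v := by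
    intro S
    induction S using Finset.strongInduction with
    | H S ih =>
      rcases S.eq_empty_or_nonempty with rfl | hS
      · exact ⟨fun _ => 0, by simp⟩
      -- Otherwise `3|S|` is at most the degree sum, which is twice the edge count and so at most
      -- `2|S|`.
      have hlow : ∃ v ∈ S, (S.filter (G.Adj v)).card ≤ 2 := by
        by_contra! hcon
        have h1 := Finset.card_nsmul_le_sum S _ 3 hcon
        rw [sum_card_filter_adj, smul_eq_mul] at h1
        have := h S
        have := hS.card_pos
        omega
      obtain ⟨v, hv, hdeg⟩ := hlow
      obtain ⟨f, hf⟩ := ih (S.erase v) (Finset.erase_ssubset hv)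
      obtain ⟨x, hx⟩ : ∃ x, x ∉ (S.filter (G.Adj v)).image f := by
        by_contra! hcon
        have h1 := Finset.card_le_card (fun y _ => hcon y :
          (Finset.univ : Finset (Fin 3)) ⊆ (S.filter (G.Adj v)).image f)
        have h2 := h1.trans (Finset.card_image_le.trans hdeg)
        simp at h2
      have hx' : ∀ w ∈ S, G.Adj v w → f w ≠ x := fun w hw hvw hwx =>
        hx (Finset.mem_image.2 ⟨w, by simp [hw, hvw], hwx⟩)
      refine ⟨Function.update f v x, fun u hu w hw huw => ?_⟩
      by_cases huv : u = v
      · subst huv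
        rw [Function.update_self, Function.update_of_ne huw.ne']
        exact (hx' w hw huw).symm
      · by_cases hwv : w = v
        · subst hwv
          rw [Function.update_self, Function.update_of_ne huv]
          exact hx' u hu huw.symm
        · rw [Function.update_of_ne huv, Function.update_of_ne hwv]
          exact hf u (Finset.mem_erase.2 ⟨huv, hu⟩) w (Finset.mem_erase.2 ⟨hwv, hw⟩) huw
  obtain ⟨f, hf⟩ := key Finset.univ
  exact ⟨Coloring.mk f fun {u v} huv => hf u (Finset.mem_univ _) v (Finset.mem_univ _) huv⟩

end SimpleGraph

/-! ### Welfare and equilibria of the games. -/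

namespace ClusteringGame

variable {V : Type*} {c : ℕ} {G : SimpleGraph V}

/-- The unit-weight equal-split coordination game on `G` in which every player `v` can only
choose `s v`, except that the players `a` and `b` can also choose `x`. -/
def twoPlayerDeviationGame (G : SimpleGraph V) (s : V → Fin c) (a b : V) (x : Fin c) :
    ClusteringGame V c where
  coord := G
  anti := ⊥
  disjoint_edges := disjoint_bot_right
  strat v := {y | y = s v ∨ ((v = a ∨ v = b) ∧ y = x)}
  strat_nonempty v := ⟨s v, Or.inl rfl⟩
  split _ _ := 1
  split_nonneg _ _ _ := zero_le_one
  split_add_pos _ _ _ := by norm_num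
  weight _ := 1
  weight_nonneg _ _ := zero_le_one
  pref _ _ := 0
  pref_nonneg _ _ _ := le_rfl

theorem twoPlayerDeviationGame_mem (G : SimpleGraph V) (s : V → Fin c) (a b : V) (x : Fin c) :
    twoPlayerDeviationGame G s a b x ∈ unitCoordinationGames G c :=
  ⟨sup_bot_eq G, rfl, fun _ _ _ => rfl, fun _ _ => rfl, fun _ _ _ => rfl⟩

variable [Fintype V]

/-- Equal split and unit weight make every share on an edge `1/2`. Being a profile matters because
preferences vanish only on the strategy sets. -/
theorem utility_eq_of_mem_unitCoordinationGames {Γ : ClusteringGame V c}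
    (hΓ : Γ ∈ unitCoordinationGames G c) {s : V → Fin c} (hs : Γ.IsProfile s) (i : V) :
    Γ.utility s i = ((Finset.univ.filter (fun j => G.Adj i j ∧ s i = s j)).card : ℝ) / 2 := by
  obtain ⟨hG, hco, heq, hun, hpr⟩ := hΓ
  replace hco : Γ.anti = ⊥ := hco
  have hcoord : Γ.coord = G := by
    rw [← hG, graph, hco, sup_bot_eq]
  have hshare : ∀ j, G.Adj i j → Γ.share i j = 1 / 2 := by
    intro j hij
    rw [← hG] at hij
    have h1 := Γ.split_add_pos i j hij
    have h2 := heq i j hij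
    have h3 : Γ.weight s(i, j) = 1 := hun _ hij
    rw [share, h3, mul_one, ← h2]
    rw [← h2] at h1
    have h4 : Γ.split i j ≠ 0 := by linarith
    field_simp; norm_num
  rw [utility, hpr i _ (hs i), hco, hcoord, zero_add]
  simp only [SimpleGraph.bot_adj, false_and, Finset.filter_false, Finset.sum_empty, add_zero]
  rw [Finset.sum_congr rfl fun j hj => hshare j (Finset.mem_filter.1 hj).2.1, Finset.sum_const,
    nsmul_eq_mul, mul_one_div]

theorem exists_isOptimal (Γ : ClusteringGame V c) : ∃ o, Γ.IsOptimal o := by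
  choose s hs using Γ.strat_nonempty
  obtain ⟨o, ho, hmax⟩ := Set.exists_max_image {s | Γ.IsProfile s} Γ.welfare (Set.toFinite _)
    ⟨s, hs⟩
  exact ⟨o, ho, hmax⟩

theorem classPriceOfAnarchy_eq_top {Γ : ClusteringGame V c} {𝒢 : Set (ClusteringGame V c)}
    (hΓ : Γ ∈ 𝒢) {ε : ℝ} {k : ℕ} {s t : V → Fin c} (hs : Γ.IsEquilibrium ε k s)
    (hs0 : Γ.welfare s = 0) (ht : Γ.IsProfile t) (ht0 : 0 < Γ.welfare t) :
    classPriceOfAnarchy 𝒢 ε k = ⊤ := by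
  obtain ⟨o, ho⟩ := Γ.exists_isOptimal
  have hpos : 0 < Γ.welfare o := ht0.trans_le (ho.2 t ht)
  rw [eq_top_iff]
  calc ⊤ = welfareRatio (Γ.welfare o) (Γ.welfare s) := by
        rw [welfareRatio, if_neg hpos.ne', hs0, ENNReal.ofReal_zero, ENNReal.div_zero]
        simpa using hpos
    _ ≤ ⨆ (s : V → Fin c) (_ : Γ.IsEquilibrium ε k s),
          welfareRatio (Γ.welfare o) (Γ.welfare s) :=
        le_iSup₂ (f := fun s (_ : Γ.IsEquilibrium ε k s) =>
          welfareRatio (Γ.welfare o) (Γ.welfare s)) s hs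
    _ ≤ Γ.priceOfAnarchy ε k :=
        le_iSup₂ (f := fun o (_ : Γ.IsOptimal o) => ⨆ (s : V → Fin c)
          (_ : Γ.IsEquilibrium ε k s), welfareRatio (Γ.welfare o) (Γ.welfare s)) o ho
    _ ≤ _ := le_iSup₂ (f := fun Γ (_ : Γ ∈ 𝒢) => Γ.priceOfAnarchy ε k) Γ hΓ

/-- If `G` is `3`-colorable and has an isolated edge, then some unit-weight equal-split
coordination game on `G` has a bad equilibrium of welfare zero. -/
theorem classPriceOfAnarchy_eq_top_of_isolated (hc : 3 ≤ c) (hG : G.Colorable 3) {a b : V}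
    (hab : G.Adj a b) (ha : ∀ w, G.Adj a w → w = b) (hb : ∀ w, G.Adj b w → w = a) (ε : ℝ) :
    classPriceOfAnarchy (unitCoordinationGames G c) ε 1 = ⊤ := by
  obtain ⟨C⟩ := hG
  -- Recoloring `a` and `b` keeps the coloring proper because they have no other neighbors, and it
  -- leaves color 2 free for `x`.
  let s : V → Fin c := fun v =>
    Fin.castLE hc (if v = a then 0 else if v = b then 1 else C v)
  let x : Fin c := Fin.castLE hc 2
  have hsa : s a = Fin.castLE hc 0 := by simp [s]
  have hsb : s b = Fin.castLE hc 1 := by simp [s, hab.ne']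
  have h01 : Fin.castLE hc 0 ≠ Fin.castLE hc 1 := by simp [Fin.ext_iff]
  have hx0 : x ≠ Fin.castLE hc 0 := by simp [x, Fin.ext_iff]
  have hx1 : x ≠ Fin.castLE hc 1 := by simp [x, Fin.ext_iff]
  have hproper : ∀ u v, G.Adj u v → s u ≠ s v := by
    intro u v huv
    by_cases hua : u = a
    · subst hua
      rw [ha v huv, hsa, hsb]
      exact h01
    by_cases hub : u = b
    · subst hub
      rw [hb v huv, hsa, hsb]
      exact h01.symm
    have hva : v ≠ a := fun h => hub (ha u (h ▸ huv.symm))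
    have hvb : v ≠ b := fun h => hua (hb u (h ▸ huv.symm))
    simp only [s, hua, hub, hva, hvb, if_false]
    exact fun h => C.valid huv (Fin.castLE_injective hc h)
  set Γ := twoPlayerDeviationGame G s a b x with hΓdef
  have hΓ : Γ ∈ unitCoordinationGames G c := twoPlayerDeviationGame_mem G s a b x
  have hsprof : Γ.IsProfile s := fun i => Or.inl rfl
  have hzero : ∀ t, Γ.IsProfile t → ∀ j, (∀ w, G.Adj j w → t j ≠ t w) → Γ.utility t j = 0 := by
    intro t ht j h
    rw [utility_eq_of_mem_unitCoordinationGames hΓ ht, Finset.filter_false_of_mem]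
    · simp
    · exact fun w _ hw => h w hw.1 hw.2
  have hs0 : ∀ j, Γ.utility s j = 0 := fun j => hzero s hsprof j fun w hw => hproper j w hw
  have heq : Γ.IsEquilibrium ε 1 s := by
    refine ⟨hsprof, fun K hK hK1 t ht hts => ?_⟩
    obtain ⟨j, hj⟩ := Finset.card_eq_one.1 (le_antisymm hK1 hK.card_pos)
    refine ⟨j, by simp [hj], ?_⟩
    rw [hs0, mul_zero, hzero t ht j]
    intro w hw
    have htw : t w = s w := hts w (by simpa [hj] using hw.ne')
    rw [htw]
    rcases ht j with h | ⟨rfl | rfl, h⟩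
    · rw [h]
      exact hproper j w hw
    · rw [h, ha w hw, hsb]
      exact hx1
    · rw [h, hb w hw, hsa]
      exact hx0
  -- The joint move, unavailable to coalitions of size one, makes `ab` monochromatic.
  let t : V → Fin c := fun v => if v = a ∨ v = b then x else s v
  have ht : Γ.IsProfile t := by
    intro v
    by_cases hv : v = a ∨ v = b
    · exact Or.inr ⟨hv, if_pos hv⟩
    · exact Or.inl (if_neg hv)
  refine classPriceOfAnarchy_eq_top hΓ heq (Finset.sum_eq_zero fun j _ => hs0 j) ht ?_
  refine Finset.sum_pos' (fun i _ => ?_) ⟨a, Finset.mem_univ a, ?_⟩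
  · rw [utility_eq_of_mem_unitCoordinationGames hΓ ht]
    exact div_nonneg (Nat.cast_nonneg _) zero_le_two
  · rw [utility_eq_of_mem_unitCoordinationGames hΓ ht]
    have : 0 < (Finset.univ.filter (fun j => G.Adj a j ∧ t a = t j)).card :=
      Finset.card_pos.2 ⟨b, by simp [hab, t]⟩
    exact div_pos (Nat.cast_pos.2 this) two_pos

theorem welfare_le {Γ : ClusteringGame V c} (hΓ : Γ ∈ unitCoordinationGames G c)
    {s : V → Fin c} (hs : Γ.IsProfile s) : Γ.welfare s ≤ (Fintype.card V : ℝ) ^ 2 / 2 := by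
  have h : ∀ i ∈ (Finset.univ : Finset V), Γ.utility s i ≤ (Fintype.card V : ℝ) / 2 := by
    intro i _
    rw [utility_eq_of_mem_unitCoordinationGames hΓ hs]
    gcongr
    exact Finset.card_le_univ _
  refine (Finset.sum_le_card_nsmul _ _ _ h).trans_eq ?_
  rw [Finset.card_univ, nsmul_eq_mul]
  ring

/-- An edge inside a color class yields `1/2` to each endpoint, hence 1 in total. -/
theorem edgesIn_le_welfare {Γ : ClusteringGame V c} (hΓ : Γ ∈ unitCoordinationGames G c)
    {s : V → Fin c} (hs : Γ.IsProfile s) (x : Fin c) :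
    (G.edgesIn (SimpleGraph.slots (Finset.univ.filter (fun i => s i = x))) : ℝ)
      ≤ Γ.welfare s := by
  set T := Finset.univ.filter (fun i => s i = x) with hT
  have h1 := SimpleGraph.sum_card_filter_adj G T
  have h2 : (G.edgesIn (SimpleGraph.slots T) : ℝ)
      = ∑ i ∈ T, ((T.filter (G.Adj i)).card : ℝ) / 2 := by
    rw [← Finset.sum_div, ← Nat.cast_sum, h1]
    push_cast
    ring
  rw [h2, welfare]
  refine (Finset.sum_le_sum fun i hi => ?_).trans
    (Finset.sum_le_sum_of_subset_of_nonneg (Finset.subset_univ T) fun i _ _ => ?_)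
  · rw [utility_eq_of_mem_unitCoordinationGames hΓ hs]
    gcongr
    intro j hj
    simp only [hT, Finset.mem_filter, Finset.mem_univ, true_and] at hi hj ⊢
    exact ⟨hj.2, hi.trans hj.1.symm⟩
  · rw [utility_eq_of_mem_unitCoordinationGames hΓ hs]
    positivity

/-- If all linear-size vertex sets of `G` span many edges, every profile of a unit-weight
equal-split coordination game on `G` is nearly optimal. -/
theorem classPriceOfAnarchy_le {n K : ℕ} (hc : 0 < c) {G : SimpleGraph (Fin n)}
    (hn : 2 ≤ n / c)
    (hG : ∀ T : Finset (Fin n), n / c ≤ T.card →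
      (n / c).choose 2 < K * G.edgesIn (SimpleGraph.slots T)) (ε : ℝ) (k : ℕ) :
    classPriceOfAnarchy (unitCoordinationGames G c) ε k
      ≤ ((8 * c ^ 2 * K : ℕ) : ℝ≥0∞) := by
  refine iSup₂_le fun Γ hΓ => iSup₂_le fun o ho => iSup₂_le fun s hs => ?_
  set m := n / c with hm
  -- Pigeonhole: some color class has at least `n / c` players.
  obtain ⟨x, -, hx⟩ := Finset.exists_le_card_fiber_of_mul_le_card_of_maps_to
    (s := (Finset.univ : Finset (Fin n))) (t := (Finset.univ : Finset (Fin c))) (f := s) (n := m)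
    (fun _ _ => Finset.mem_univ _) ⟨⟨0, hc⟩, Finset.mem_univ _⟩
    (by simpa using Nat.mul_div_le n c)
  have h1 := hG _ hx
  have h2 := edgesIn_le_welfare hΓ hs.1 x
  set X := G.edgesIn (SimpleGraph.slots (Finset.univ.filter (fun i => s i = x))) with hX
  have hKX : 0 < K * X := (Nat.zero_le _).trans_lt h1
  have hXpos : 0 < X := Nat.pos_of_mul_pos_left hKX
  have hKpos : 0 < K := Nat.pos_of_mul_pos_right hKX
  have hw : 0 < Γ.welfare s := lt_of_lt_of_le (by exact_mod_cast hXpos) h2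
  -- From `m ≥ 2`: `n ≤ c(m+1) ≤ 2cm` and `m² ≤ 4 · m.choose 2`, so `n²/2 ≤ 2c²m² ≤ 8c²KX`.
  have hmain : Γ.welfare o ≤ (8 * c ^ 2 * K : ℕ) * Γ.welfare s := by
    have hnm : n ≤ c * (m + 1) := (Nat.lt_mul_div_succ n hc).le
    have hnm' : (n : ℝ) ≤ c * (m + 1) := by exact_mod_cast hnm
    have hm2 : (2 : ℝ) ≤ m := by exact_mod_cast hn
    have hnm2 : (n : ℝ) ≤ 2 * c * m := by nlinarith [(Nat.cast_nonneg c : (0 : ℝ) ≤ c)]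
    have h3 : ((m.choose 2 : ℕ) : ℝ) ≤ K * X := by exact_mod_cast h1.le
    rw [Nat.cast_choose_two] at h3
    have h4 : (m : ℝ) ^ 2 ≤ 4 * (K * X) := by nlinarith
    calc Γ.welfare o ≤ (n : ℝ) ^ 2 / 2 := by simpa using welfare_le hΓ ho.1
      _ ≤ (2 * c * m) ^ 2 / 2 := by gcongr
      _ = 2 * c ^ 2 * m ^ 2 := by ring
      _ ≤ 2 * c ^ 2 * (4 * (K * X)) := by gcongr
      _ = (8 * c ^ 2 * K : ℕ) * X := by push_cast; ring
      _ ≤ _ := by gcongr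
  rw [welfareRatio]
  split_ifs with h0
  -- Here the ratio takes its conventional value 1.
  · have : 1 ≤ 8 * c ^ 2 * K := Nat.succ_le_of_lt (by positivity)
    exact_mod_cast this
  · refine ENNReal.div_le_of_le_mul ?_
    rw [← ENNReal.ofReal_natCast, ← ENNReal.ofReal_mul (Nat.cast_nonneg _)]
    exact ENNReal.ofReal_le_ofReal hmain

end ClusteringGame

end Auxiliary

/-! ### The two limits. -/

theorem tendsto_classPriceOfAnarchy_eq_top {c : ℕ} (hc : 3 ≤ c) (ε : ℝ) {p : ℕ → unitInterval}
    (hp : ∀ n : ℕ, 1 ≤ n → (p n : ℝ) ≤ 1 / 18 / n)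
    (hlim : Tendsto (fun n : ℕ => (n : ℝ) ^ 2 * (p n : ℝ)) atTop atTop) :
    Tendsto (fun n : ℕ => SimpleGraph.binomialRandom (Fin n) (p n)
      {G | ClusteringGame.classPriceOfAnarchy
        (ClusteringGame.unitCoordinationGames G c) ε 1 = ⊤}) atTop (𝓝 1) := by
  have hp0 : Tendsto (fun n => (p n : ℝ)) atTop (𝓝 0) :=
    squeeze_zero' (Eventually.of_forall fun n => (p n).2.1)
      ((eventually_ge_atTop 1).mono hp) (tendsto_const_div_atTop_nhds_zero_nat _)
  -- The first error term bounds the failure of sparsity, the rest the absence of an isolated edge.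
  refine SimpleGraph.tendsto_measure_one (r := fun n => 2 / (n : ℝ) +
    (8 * ((n : ℝ) ^ 2 * p n)⁻¹ + (1 / (1 - p n : ℝ) ^ 4 - 1))) ?_ ?_
  · have h1 : Tendsto (fun n => 1 / (1 - p n : ℝ) ^ 4 - 1) atTop (𝓝 (1 / (1 - 0) ^ 4 - 1)) :=
      (tendsto_const_nhds.div ((hp0.const_sub 1).pow 4) (by norm_num)).sub_const 1
    have h2 := (tendsto_const_div_atTop_nhds_zero_nat (2 : ℝ)).add
      ((hlim.inv_tendsto_atTop.const_mul 8).add h1)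
    simpa using h2
  · filter_upwards [eventually_ge_atTop 2, hlim.eventually_gt_atTop 0] with n hn hpos
    have hpn := hp n (by omega)
    have hp' : 0 < (p n : ℝ) := pos_of_mul_pos_right hpos (by positivity)
    refine (MeasureTheory.measureReal_mono ?_ (MeasureTheory.measure_ne_top _ _)).trans
      ((MeasureTheory.measureReal_union_le _ _).trans (add_le_add
        (SimpleGraph.measureReal_exists_card_lt_edgesIn_le (by omega) (p n) hpn)
        (SimpleGraph.measureReal_no_isolatedEdge_le hn (p n) hp' hpn)))
    intro G hG
    by_contra hcon
    simp only [Set.mem_union, Set.mem_ofPred_eq, not_or, not_exists, not_lt, not_forall,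
      not_not] at hcon
    obtain ⟨hsparse, e, he, hiso⟩ := hcon
    induction e with
    | _ a b =>
      refine hG (ClusteringGame.classPriceOfAnarchy_eq_top_of_isolated hc
        (SimpleGraph.colorable_three_of_edgesIn_le G hsparse) (a := a) (b := b) hiso.1
        (fun w hw => ?_) (fun w hw => ?_) ε)
      · by_contra hwb
        refine hiso.2 s(a, w) (SimpleGraph.mem_incidentSlots.2 ⟨by simpa using hw.ne, ?_, a, ?_⟩) hw
        · simpa [hwb] using fun h h' => hwb (h'.trans h)
        · simp
      · by_contra hwa
        refine hiso.2 s(b, w) (SimpleGraph.mem_incidentSlots.2 ⟨by simpa using hw.ne, ?_, b, ?_⟩) hw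
        · rw [Sym2.eq_swap (a := b)]
          simpa [hwa] using fun h h' => hwa (h.trans h')
        · simp

theorem exists_tendsto_classPriceOfAnarchy_le {c : ℕ} (hc : 0 < c) {p : unitInterval}
    (hp : 0 < p) :
    ∃ β₀ : ℝ≥0, ∀ ε : ℝ, Tendsto (fun n : ℕ => SimpleGraph.binomialRandom (Fin n) p
      {G | ClusteringGame.classPriceOfAnarchy
        (ClusteringGame.unitCoordinationGames G c) ε 1 ≤ (β₀ : ℝ≥0∞)}) atTop (𝓝 1) := by
  obtain ⟨K, -, hK⟩ := SimpleGraph.exists_measureReal_edgesIn_le hc p hp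
  refine ⟨(8 * c ^ 2 * K : ℕ), fun ε => ?_⟩
  have hdiv : Tendsto (fun n : ℕ => n / c) atTop atTop := Nat.tendsto_div_const_atTop hc.ne'
  refine SimpleGraph.tendsto_measure_one (p := fun _ => p)
    (r := fun n => (2 : ℝ) ^ c * (1 / 2) ^ (n / c)) ?_ ?_
  · simpa using ((tendsto_pow_atTop_nhds_zero_of_lt_one (r := (1 / 2 : ℝ)) (by norm_num)
      (by norm_num)).comp hdiv).const_mul ((2 : ℝ) ^ c)
  · filter_upwards [hK, hdiv.eventually_ge_atTop 2] with n hn hn2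
    refine (MeasureTheory.measureReal_mono ?_ (MeasureTheory.measure_ne_top _ _)).trans hn
    intro G hG
    by_contra hcon
    simp only [Set.mem_ofPred_eq, not_exists, not_and, not_le] at hcon
    exact hG (by simpa using ClusteringGame.classPriceOfAnarchy_le hc hn2 hcon ε 1)

theorem theorem10 (c : ℕ) (hc : 3 ≤ c) :
    (∃ d : ℝ, 0 < d ∧
      ∀ ε : ℝ, 1 ≤ ε → ∀ p : ℕ → unitInterval,
        (∀ n : ℕ, 1 ≤ n → (p n : ℝ) ≤ d / n) →
        Tendsto (fun n : ℕ => (n : ℝ) ^ 2 * (p n : ℝ)) atTop atTop →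
        Tendsto
          (fun n : ℕ => SimpleGraph.binomialRandom (Fin n) (p n)
            {G | ClusteringGame.classPriceOfAnarchy
              (ClusteringGame.unitCoordinationGames G c) ε 1 = ⊤})
          atTop (𝓝 1)) ∧
    (∀ p : unitInterval, 0 < p → p < 1 →
      ∃ β₀ : ℝ≥0, ∀ ε : ℝ, 1 ≤ ε →
        Tendsto
          (fun n : ℕ => SimpleGraph.binomialRandom (Fin n) p
            {G | ClusteringGame.classPriceOfAnarchy
              (ClusteringGame.unitCoordinationGames G c) ε 1 ≤ (β₀ : ℝ≥0∞)})
          atTop (𝓝 1)) := by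
  refine ⟨⟨1 / 18, by norm_num, fun ε _ p hp hlim =>
    tendsto_classPriceOfAnarchy_eq_top hc ε hp hlim⟩, fun p hp _ => ?_⟩
  obtain ⟨β₀, h⟩ := exists_tendsto_classPriceOfAnarchy_le (show 0 < c by omega) hp
  exact ⟨β₀, fun ε _ => h ε⟩
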